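/- Let $l\ge 2$, $N=2l+2$, and let $U\subset\mathbb R^2$ be open, with coordinates $z=(x+iy)/2$, $\bar z=(x-iy)/2$, so that $\partial_z=\partial_x-i\partial_y$, $\partial_{\bar z}=\partial_x+i\partial_y$ and $\triangle=\partial_z\partial_{\bar z}=\partial_x^2+\partial_y^2$. The two dimensional elliptic $D_{l+1}^{(2)}$ Toda equation for real functions $u_1,\dots,u_l\in C^2(U)$ is $$\triangle u_1=e^{u_1}-e^{u_2-u_1},\qquad \triangle u_j=e^{u_j-u_{j-1}}-e^{u_{j+1}-u_j}\ (2\le j\le l-1),\qquad \triangle u_l=e^{u_l-u_{l-1}}-e^{-u_l}.$$ Subscripts of vectors and matrices of size $N$ are read modulo $N$, and $\{k\}\in\{0,\dots,N-1\}$ is the remainder of the integer $k$ modulo $N$. Let $J=(\delta_{j+1,k})_{1\le j,k\le N}$, and let $V$ be the diagonal matrix with $V_{11}=V_{l+2,l+2}=1$, $V_{j+1,j+1}=e^{u_j}$, $V_{2l+3-j,2l+3-j}=e^{-u_j}$ $(1\le j\le l)$. Let $(u_1,\dots,u_l)$ be a solution of the Toda equation on $U$, let $\mu\in\mathbb C$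 with $\mu\ne0$, $|\mu|\ne1$, and let $h=(h_1,\dots,h_{2l+2})^T:U\to\mathbb C^{2l+2}$ be a (real-differentiable) solution of the Lax pair $$h_z=(\mu J+V_zV^{-1})h,\qquad h_{\bar z}=\mu^{-1}VJ^TV^{-1}h$$ which satisfies on $U$ the constraint $$h_1^2+(-1)^{l+1}h_{l+2}^2+2\sum_{c=2}^{l+1}(-1)^{c-1}h_ch_{2-c}=0 .$$ Put $$\gamma_j=\frac1{1-|\mu|^{4l+4}}\Big((-|\mu|^2)^{\{j-1\}}|h_1|^2+(-|\mu|^2)^{\{j+l\}}|h_{l+2}|^2+\sum_{c=1}^{l}(-|\mu|^2)^{\{j+c-1\}}|h_{1+c}|^2e^{-u_c}+\sum_{c=1}^{l}(-|\mu|^2)^{\{j-c-1\}}|h_{1-c}|^2e^{u_c}\Big),$$ $$g_j=\frac1{(2l+2)^2}\Big|\sum_{c=1}^{2l+2}(-1)^c\{c-j-1\}h_{2-c}h_c\Big|^2-|\mu|^2\gamma_j\gamma_{1-j}.$$ If $g_{j+1}/g_j>0$ on $U$ for $j=1,\dots,l$, then the functions $$\widetilde u_j=u_j+\ln\frac{g_{j+1}}{g_j}\qquad(j=1,\dots,l)$$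 form a solution of class $C^2$ of the same Toda equation on $U$. -/

import Mathlib

namespace D2Toda

/-- The operator `∂_z` for the coordinate `z = (x + i y) / 2` on the plane, a point `(x, y)` of which
is written as the complex number `x + i y`. Thus `∂_z = ∂_x - i ∂_y`. -/
noncomputable def dz (f : ℂ → ℂ) (p : ℂ) : ℂ :=
  fderiv ℝ f p 1 - Complex.I * fderiv ℝ f p Complex.I

/-- The operator `∂_z̄` for `z̄ = (x - i y) / 2`, that is, `∂_x + i ∂_y`. -/
noncomputable def dzbar (f : ℂ → ℂ) (p : ℂ) : ℂ :=
  fderiv ℝ f p 1 + Complex.I * fderiv ℝ f p Complex.I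

/-- `(u 1, …, u l)` is a real (twice continuously differentiable) solution on `U` of the two
dimensional elliptic `D_{l+1}^{(2)}` Toda equation, `l ≥ 2`. Only the functions `u j` with
`1 ≤ j ≤ l` are used. The Laplacian is `∂_z ∂_z̄ = ∂_x² + ∂_y²`. -/
structure IsTodaSolution (l : ℕ) (U : Set ℂ) (u : ℕ → ℂ → ℝ) : Prop where
  contDiffOn : ∀ j, 1 ≤ j → j ≤ l → ContDiffOn ℝ 2 (u j) U
  eq_first : ∀ p ∈ U,
    Laplacian.laplacian (u 1) p = Real.exp (u 1 p) - Real.exp (u 2 p - u 1 p)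
  eq_middle : ∀ j, 2 ≤ j → j < l → ∀ p ∈ U,
    Laplacian.laplacian (u j) p =
      Real.exp (u j p - u (j - 1) p) - Real.exp (u (j + 1) p - u j p)
  eq_last : ∀ p ∈ U,
    Laplacian.laplacian (u l) p = Real.exp (u l p - u (l - 1) p) - Real.exp (-u l p)

/-- The exponents of the diagonal of `V`, with indices modulo `2l + 2`: `0` at the indices `1` and
`l + 2`, `u j` at `j + 1` and `-u j` at `2l + 3 - j`, for `1 ≤ j ≤ l`. -/
def exponent (l : ℕ) (u : ℕ → ℂ → ℝ) (c : ZMod (2 * l + 2)) (p : ℂ) : ℝ :=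
  let k := (c - 1).val
  if k = 0 then 0
  else if k ≤ l then u k p
  else if k = l + 1 then 0
  else -u (2 * l + 2 - k) p

/-- The diagonal matrix `V = diag(1, e^{u_1}, …, e^{u_l}, 1, e^{-u_l}, …, e^{-u_1})`. -/
noncomputable def V (l : ℕ) (u : ℕ → ℂ → ℝ) (p : ℂ) :
    Matrix (ZMod (2 * l + 2)) (ZMod (2 * l + 2)) ℂ :=
  Matrix.diagonal fun c => (Real.exp (exponent l u c p) : ℂ)

/-- The matrix `J` with entries `J_{jk} = δ_{j+1,k}`, indices modulo `2l + 2`. -/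
def J (l : ℕ) : Matrix (ZMod (2 * l + 2)) (ZMod (2 * l + 2)) ℂ :=
  Matrix.of fun j k => if j + 1 = k then 1 else 0

/-- `P = V_z V⁻¹`. -/
noncomputable def P (l : ℕ) (u : ℕ → ℂ → ℝ) (p : ℂ) :
    Matrix (ZMod (2 * l + 2)) (ZMod (2 * l + 2)) ℂ :=
  Matrix.of (fun j k => dz (fun q => V l u q j k) p) * (V l u p)⁻¹

/-- `Q = V Jᵀ V⁻¹`. -/
noncomputable def Q (l : ℕ) (u : ℕ → ℂ → ℝ) (p : ℂ) :
    Matrix (ZMod (2 * l + 2)) (ZMod (2 * l + 2)) ℂ :=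
  V l u p * (J l).transpose * (V l u p)⁻¹

/-- The column `h = (h_1, …, h_{2l+2})ᵀ` (indices modulo `2l + 2`) is a solution on `U` of the Lax
pair `h_z = (μ J + P) h`, `h_z̄ = μ⁻¹ Q h` of the potentials `u` with spectral parameter `μ`. -/
structure IsLaxSolution (l : ℕ) (U : Set ℂ) (u : ℕ → ℂ → ℝ) (μ : ℂ)
    (h : ZMod (2 * l + 2) → ℂ → ℂ) : Prop where
  differentiableOn : ∀ c, DifferentiableOn ℝ (h c) U
  eq_dz : ∀ p ∈ U, ∀ c, dz (h c) p = ((μ • J l + P l u p).mulVec fun k => h k p) c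
  eq_dzbar : ∀ p ∈ U, ∀ c, dzbar (h c) p = ((μ⁻¹ • Q l u p).mulVec fun k => h k p) c

/-- The function `γ_j`; the remainder of an integer `k` modulo `2l + 2` is `(k : ZMod (2l+2)).val`. -/
noncomputable def γ (l : ℕ) (u : ℕ → ℂ → ℝ) (μ : ℂ) (h : ZMod (2 * l + 2) → ℂ → ℂ)
    (j : ZMod (2 * l + 2)) (p : ℂ) : ℝ :=
  1 / (1 - ‖μ‖ ^ (4 * l + 4)) *
    ((-‖μ‖ ^ 2) ^ (j - 1).val * ‖h 1 p‖ ^ 2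
      + (-‖μ‖ ^ 2) ^ (j + (l : ZMod (2 * l + 2))).val * ‖h ((l : ZMod (2 * l + 2)) + 2) p‖ ^ 2
      + ∑ c ∈ Finset.Icc 1 l,
          (-‖μ‖ ^ 2) ^ (j + (c : ZMod (2 * l + 2)) - 1).val
            * ‖h (1 + (c : ZMod (2 * l + 2))) p‖ ^ 2 * Real.exp (-u c p)
      + ∑ c ∈ Finset.Icc 1 l,
          (-‖μ‖ ^ 2) ^ (j - (c : ZMod (2 * l + 2)) - 1).val
            * ‖h (1 - (c : ZMod (2 * l + 2))) p‖ ^ 2 * Real.exp (u c p))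

/-- The function
`g_j = (2l+2)⁻² |∑_{c=1}^{2l+2} (-1)^c {c-j-1} h_{2-c} h_c|² - |μ|² γ_j γ_{1-j}`,
where `{k}` is the remainder of `k` modulo `2l + 2`. -/
noncomputable def g (l : ℕ) (u : ℕ → ℂ → ℝ) (μ : ℂ) (h : ZMod (2 * l + 2) → ℂ → ℂ)
    (j : ZMod (2 * l + 2)) (p : ℂ) : ℝ :=
  1 / (2 * (l : ℝ) + 2) ^ 2 *
      ‖∑ c ∈ Finset.Icc 1 (2 * l + 2),
        (-1 : ℂ) ^ c * (((c : ZMod (2 * l + 2)) - j - 1).val : ℂ)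
          * h (2 - (c : ZMod (2 * l + 2))) p * h (c : ZMod (2 * l + 2)) p‖ ^ 2
    - ‖μ‖ ^ 2 * γ l u μ h j p * γ l u μ h (1 - j) p

/-- The Darboux transform `ũ_j = u_j + ln (g_{j+1} / g_j)`. -/
noncomputable def darboux (l : ℕ) (u : ℕ → ℂ → ℝ) (μ : ℂ) (h : ZMod (2 * l + 2) → ℂ → ℂ)
    (j : ℕ) (p : ℂ) : ℝ :=
  u j p + Real.log (g l u μ h ((j : ZMod (2 * l + 2)) + 1) p / g l u μ h (j : ZMod (2 * l + 2)) p)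

end D2Toda

/-! Write `w_c` for the exponents of `V`, `N = 2l + 2`, `s = -|μ|²`, and let `β_j` be the sum inside
`g_j` divided by `N`, so that `g_j = |β_j|² - |μ|² γ_j γ_{1-j}`. Everything rests on one equation:
`Δ ln g_j = e^{w_{j+1} - w_j} (1 - g_{j+1} g_{j-1} / g_j²)`. Since `w_{j+1} = u_j` for `1 ≤ j ≤ l`,
in `Δ u_j + Δ ln g_{j+1} - Δ ln g_j` the exponentials of the old Toda equation cancel and those of
the new one remain. The chain closes at both ends because `g_{1-j} = g_j`, whence `g_0 = g_1` and
`g_{l+2} = g_{l+1}`.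

The equation holds because `γ` and `β` are discrete primitives in `j`. The weights `s^{k}` and `{k}`
solve first order recurrences except for a jump where the remainder wraps around, so summation by
parts leaves one term: `γ_j - s γ_{j-1} = |h_{2-j}|² / V_{2-j}` (`γ_sub_one`), and, the constraint
removing the constant part, `β_j - β_{j-1} = (-1)^j h_{2-j} h_j` (`β_sub_one`). By the Lax pair the
derivatives of each summand are themselves sums or differences of neighbours, so the same mechanism
makes `∂_z γ_j` and `∂_z β_j` single products (`hasWirt_γ`, `hasWirt_β`). Then `g_j Δ g_j - |∂_z
g_j|²` and `g_{j+1} g_{j-1}` are explicit expressions in `β_j`, `γ_j`, `γ_{1-j}`, four components of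
`h` and two entries of `V`; comparing them is algebra (`g_bilinear`). The Toda equation for `u`
enters only in the final cancellation. -/

namespace D2Toda

/-! ### Wirtinger calculus -/

/-- The real linear map `v ↦ (a v + b v̄) / 2`, the differential with `∂_z`-derivative `a` and
`∂_z̄`-derivative `b`. -/
noncomputable def wirtingerMap (a b : ℂ) : ℂ →L[ℝ] ℂ :=
  (a / 2) • ContinuousLinearMap.id ℝ ℂ + (b / 2) • (Complex.conjCLE : ℂ →L[ℝ] ℂ)

theorem wirtingerMap_apply (a b v : ℂ) :
    wirtingerMap a b v = a / 2 * v + b / 2 * starRingEnd ℂ v := by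
  simp [wirtingerMap]

/-- `f` is real differentiable at `p` with `∂_z f = a` and `∂_z̄ f = b`. -/
def HasWirt (f : ℂ → ℂ) (a b p : ℂ) : Prop := HasFDerivAt f (wirtingerMap a b) p

theorem eq_wirtingerMap (L : ℂ →L[ℝ] ℂ) :
    L = wirtingerMap (L 1 - Complex.I * L Complex.I) (L 1 + Complex.I * L Complex.I) := by
  ext v
  have hv : v = v.re • (1 : ℂ) + v.im • Complex.I := by simp [Complex.re_add_im]
  have hL : L v = v.re * L 1 + v.im * L Complex.I := by
    conv_lhs => rw [hv]
    rw [map_add, map_smul, map_smul, Complex.real_smul, Complex.real_smul]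
  have hc : starRingEnd ℂ v = v.re - v.im * Complex.I := by
    apply Complex.ext <;> simp
  rw [hL, wirtingerMap_apply, hc]
  nth_rewrite 3 [hv]
  simp only [Complex.real_smul, mul_one]
  linear_combination (v.im * L Complex.I) * Complex.I_mul_I

theorem hasWirt_of_differentiableAt {f : ℂ → ℂ} {p : ℂ} (hf : DifferentiableAt ℝ f p) :
    HasWirt f (dz f p) (dzbar f p) p := by
  unfold HasWirt dz dzbar
  rw [← eq_wirtingerMap]
  exact hf.hasFDerivAt

namespace HasWirt

variable {f k : ℂ → ℂ} {a b c d p : ℂ}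

theorem dz_eq (hf : HasWirt f a b p) : dz f p = a := by
  rw [dz, HasFDerivAt.fderiv hf]
  simp only [wirtingerMap_apply, map_one, Complex.conj_I]
  linear_combination (b / 2 - a / 2) * Complex.I_mul_I

theorem dzbar_eq (hf : HasWirt f a b p) : dzbar f p = b := by
  rw [dzbar, HasFDerivAt.fderiv hf]
  simp only [wirtingerMap_apply, map_one, Complex.conj_I]
  linear_combination (a / 2 - b / 2) * Complex.I_mul_I

theorem differentiableAt (hf : HasWirt f a b p) : DifferentiableAt ℝ f p :=
  HasFDerivAt.differentiableAt hf

theorem congr_coeff (hf : HasWirt f a b p) (ha : a = c) (hb : b = d) : HasWirt f c d p := by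
  rwa [← ha, ← hb]

theorem const (a p : ℂ) : HasWirt (fun _ => a) 0 0 p := by
  have : wirtingerMap 0 0 = 0 := by ext v; simp [wirtingerMap_apply]
  rw [HasWirt, this]
  exact hasFDerivAt_const a p

theorem add (hf : HasWirt f a b p) (hk : HasWirt k c d p) :
    HasWirt (fun q => f q + k q) (a + c) (b + d) p := by
  have : wirtingerMap (a + c) (b + d) = wirtingerMap a b + wirtingerMap c d := by
    ext v; simp only [wirtingerMap_apply, add_apply]; ring
  rw [HasWirt, this]
  exact HasFDerivAt.add hf hk

theorem neg (hf : HasWirt f a b p) : HasWirt (fun q => -f q) (-a) (-b) p := by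
  have : wirtingerMap (-a) (-b) = -wirtingerMap a b := by
    ext v; simp only [wirtingerMap_apply, neg_apply]; ring
  rw [HasWirt, this]
  exact HasFDerivAt.neg hf

theorem sub (hf : HasWirt f a b p) (hk : HasWirt k c d p) :
    HasWirt (fun q => f q - k q) (a - c) (b - d) p := by
  simpa only [sub_eq_add_neg] using hf.add hk.neg

theorem mul (hf : HasWirt f a b p) (hk : HasWirt k c d p) :
    HasWirt (fun q => f q * k q) (a * k p + f p * c) (b * k p + f p * d) p := by
  have : wirtingerMap (a * k p + f p * c) (b * k p + f p * d)
      = f p • wirtingerMap c d + k p • wirtingerMap a b := by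
    ext v
    simp only [wirtingerMap_apply, add_apply, smul_apply,
      smul_eq_mul]
    ring
  rw [HasWirt, this]
  exact HasFDerivAt.mul hf hk

theorem const_mul (hf : HasWirt f a b p) (c : ℂ) : HasWirt (fun q => c * f q) (c * a) (c * b) p :=
  ((const c p).mul hf).congr_coeff (by ring) (by ring)

theorem conj (hf : HasWirt f a b p) :
    HasWirt (fun q => starRingEnd ℂ (f q)) (starRingEnd ℂ b) (starRingEnd ℂ a) p := by
  have : wirtingerMap (starRingEnd ℂ b) (starRingEnd ℂ a)
      = (Complex.conjCLE : ℂ →L[ℝ] ℂ).comp (wirtingerMap a b) := by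
    ext v
    simp [wirtingerMap_apply, map_ofNat]
    ring
  rw [HasWirt, this]
  exact (Complex.conjCLE : ℂ →L[ℝ] ℂ).hasFDerivAt.comp p hf

theorem sum {ι : Type*} (s : Finset ι) {F : ι → ℂ → ℂ} {A B : ι → ℂ}
    (hF : ∀ i ∈ s, HasWirt (F i) (A i) (B i) p) :
    HasWirt (fun q => ∑ i ∈ s, F i q) (∑ i ∈ s, A i) (∑ i ∈ s, B i) p := by
  classical
  induction s using Finset.induction_on with
  | empty => simpa using const 0 p
  | insert i s hi ih =>
    simp only [Finset.sum_insert hi]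
    exact (hF i (Finset.mem_insert_self i s)).add
      (ih fun j hj => hF j (Finset.mem_insert_of_mem hj))

theorem inv (hf : HasWirt f a b p) (h0 : f p ≠ 0) :
    HasWirt (fun q => (f q)⁻¹) (-a / f p ^ 2) (-b / f p ^ 2) p := by
  have h1 : HasDerivAt (fun w : ℂ => w⁻¹) (-(f p ^ 2)⁻¹) (f p) := hasDerivAt_inv h0
  have h2 := h1.hasFDerivAt.restrictScalars ℝ |>.comp p hf
  have : wirtingerMap (-a / f p ^ 2) (-b / f p ^ 2) =
      ((ContinuousLinearMap.toSpanSingleton ℂ (-(f p ^ 2)⁻¹)).restrictScalars ℝ).comp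
        (wirtingerMap a b) := by
    ext v
    simp [wirtingerMap_apply]
    ring
  rw [HasWirt, this]
  exact h2

theorem div (hf : HasWirt f a b p) (hk : HasWirt k c d p) (h0 : k p ≠ 0) :
    HasWirt (fun q => f q / k q) (a / k p - f p * c / k p ^ 2) (b / k p - f p * d / k p ^ 2) p := by
  simp only [div_eq_mul_inv (f _)]
  exact (hf.mul (hk.inv h0)).congr_coeff (by ring) (by ring)

theorem real_comp {r : ℂ → ℝ} (hr : HasWirt (fun q => (r q : ℂ)) a b p) {φ : ℝ → ℝ} {φ' : ℝ}
    (hφ : HasDerivAt φ φ' (r p)) :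
    HasWirt (fun q => (φ (r q) : ℂ)) (φ' * a) (φ' * b) p := by
  have h1 : HasFDerivAt r (Complex.reCLM.comp (wirtingerMap a b)) p :=
    Complex.reCLM.hasFDerivAt.comp p hr
  -- The differential of a real function is real valued, so taking real parts loses nothing.
  have h2 : Complex.ofRealCLM.comp (Complex.reCLM.comp (wirtingerMap a b)) = wirtingerMap a b :=
    (Complex.ofRealCLM.hasFDerivAt.comp p h1).unique hr
  have h3 := Complex.ofRealCLM.hasFDerivAt.comp p (hφ.comp_hasFDerivAt p h1)
  have : wirtingerMap (φ' * a) (φ' * b) =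
      Complex.ofRealCLM.comp (φ' • (Complex.reCLM.comp (wirtingerMap a b))) := by
    rw [ContinuousLinearMap.comp_smul, h2]
    ext v
    simp only [wirtingerMap_apply, smul_apply, Complex.real_smul]
    ring
  rw [HasWirt, this]
  exact h3

end HasWirt

/-- The differential depends linearly on the two Wirtinger derivatives. This gains one order of
smoothness when bootstrapping the Lax pair. -/
theorem contDiffOn_succ_of_hasWirt {U : Set ℂ} (hU : IsOpen U) {f A B : ℂ → ℂ} {n : ℕ}
    (hf : ∀ p ∈ U, HasWirt f (A p) (B p) p) (hA : ContDiffOn ℝ n A U) (hB : ContDiffOn ℝ n B U) :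
    ContDiffOn ℝ (n + 1) f U := by
  rw [contDiffOn_succ_iff_fderiv_of_isOpen hU]
  refine ⟨fun p hp => (hf p hp).differentiableAt.differentiableWithinAt, by simp, ?_⟩
  have h1 : ContDiffOn ℝ n (fun p => wirtingerMap (A p) (B p)) U := by
    unfold wirtingerMap
    exact ((hA.div_const 2).smul contDiffOn_const).add ((hB.div_const 2).smul contDiffOn_const)
  exact h1.congr fun p hp => HasFDerivAt.fderiv (hf p hp)

theorem contDiffOn_dz {U : Set ℂ} (hU : IsOpen U) {f : ℂ → ℂ} {n : ℕ}
    (hf : ContDiffOn ℝ (n + 1) f U) : ContDiffOn ℝ n (dz f) U := by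
  have h1 : ContDiffOn ℝ n (fderiv ℝ f) U :=
    ((contDiffOn_succ_iff_fderiv_of_isOpen hU).1 hf).2.2
  exact (h1.clm_apply contDiffOn_const).sub
    (contDiffOn_const.mul (h1.clm_apply contDiffOn_const))

/-- The Laplacian is `∂_z̄ ∂_z`. -/
theorem laplacian_eq_of_hasWirt {U : Set ℂ} (hU : IsOpen U) {f : ℂ → ℝ} {A B : ℂ → ℂ} {c d p : ℂ}
    (hp : p ∈ U) (hf2 : ContDiffOn ℝ 2 f U)
    (hf : ∀ q ∈ U, HasWirt (fun q => (f q : ℂ)) (A q) (B q) q) (hA : HasWirt A c d p) :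
    ((Laplacian.laplacian f p : ℝ) : ℂ) = d := by
  have hfp : ContDiffAt ℝ 2 f p := hf2.contDiffAt (hU.mem_nhds hp)
  set F : ℂ → ℂ := fun q => (f q : ℂ) with hF
  have hFp : ContDiffAt ℝ 2 F p := Complex.ofRealCLM.contDiff.contDiffAt.comp p hfp
  have h1 : ((Laplacian.laplacian f p : ℝ) : ℂ) = Laplacian.laplacian F p :=
    (hfp.laplacian_CLM_comp_left (l := Complex.ofRealCLM)).symm
  have hD : HasFDerivAt (fderiv ℝ F) (fderiv ℝ (fderiv ℝ F) p) p :=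
    ((hFp.fderiv_right (m := 1) (by norm_num)).differentiableAt (by norm_num)).hasFDerivAt
  -- Symmetry cancels the mixed terms of `(∂_x + i ∂_y)(∂_x - i ∂_y)`.
  have hsymm : fderiv ℝ (fderiv ℝ F) p Complex.I 1 = fderiv ℝ (fderiv ℝ F) p 1 Complex.I :=
    hFp.isSymmSndFDerivAt (by simp) Complex.I 1
  have hA' : A =ᶠ[nhds p] fun q => fderiv ℝ F q 1 - Complex.I * fderiv ℝ F q Complex.I := by
    filter_upwards [hU.mem_nhds hp] with q hq
    exact (hf q hq).dz_eq.symm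
  have hv (v : ℂ) : HasFDerivAt (fun q => fderiv ℝ F q v)
      ((ContinuousLinearMap.apply ℝ ℂ v).comp (fderiv ℝ (fderiv ℝ F) p)) p :=
    (ContinuousLinearMap.apply ℝ ℂ v).hasFDerivAt.comp p hD
  have h2 := ((hv 1).sub ((hv Complex.I).const_mul Complex.I)).congr_of_eventuallyEq hA'
  have h3 := hA.dzbar_eq
  rw [dzbar, HasFDerivAt.fderiv h2] at h3
  simp only [sub_apply, smul_apply,
    ContinuousLinearMap.comp_apply, ContinuousLinearMap.apply_apply, smul_eq_mul] at h3
  rw [h1, InnerProductSpace.laplacian_eq_iteratedFDeriv_complexPlane, ← h3]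
  simp only [iteratedFDeriv_two_apply, Matrix.cons_val_zero, Matrix.cons_val_one, hsymm]
  linear_combination (fderiv ℝ (fderiv ℝ F) p Complex.I Complex.I) * Complex.I_mul_I

/-! ### Sums over `ZMod (2 * l + 2)` -/

theorem sum_zmod_eq_sum_range {n : ℕ} [NeZero n] {M : Type*} [AddCommMonoid M] (F : ZMod n → M) :
    ∑ c, F c = ∑ k ∈ Finset.range n, F k := by
  symm
  refine Finset.sum_bij' (fun k _ => (k : ZMod n)) (fun c _ => c.val) ?_ ?_ ?_ ?_ ?_
  · simp
  · intro c _; simpa using ZMod.val_lt c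
  · intro k hk; exact ZMod.val_cast_of_lt (Finset.mem_range.1 hk)
  · intro c _; exact ZMod.natCast_zmod_val c
  · simp

theorem sum_Icc_eq_sum_zmod {n : ℕ} [NeZero n] {M : Type*} [AddCommMonoid M] (F : ZMod n → M) :
    ∑ c ∈ Finset.Icc 1 n, F (c : ZMod n) = ∑ c, F c := by
  have h1 : Finset.Icc 1 n = Finset.Ico (0 + 1) (n + 1) := by ext; simp
  rw [h1, ← Finset.sum_Ico_add' (fun k : ℕ => F (k : ZMod n)), ← Finset.range_eq_Ico,
    ← Equiv.sum_comp (Equiv.addRight 1) F, sum_zmod_eq_sum_range]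
  simp

/-- `γ` and the constraint are given in this split form; reindexing arguments need the sum over all
residues. -/
theorem sum_zmod_split {l : ℕ} {M : Type*} [AddCommGroup M] (F : ZMod (2 * l + 2) → M) :
    ∑ c, F c = F 1 + F ((l : ZMod (2 * l + 2)) + 2) + ∑ c ∈ Finset.Icc 1 l, F (1 + c)
      + ∑ c ∈ Finset.Icc 1 l, F (1 - c) := by
  have h1 : ∑ c, F c = ∑ k ∈ Finset.Ico 0 (2 * l + 2), F (1 + k) := by
    rw [← Equiv.sum_comp (Equiv.addLeft 1) F, sum_zmod_eq_sum_range, Finset.range_eq_Ico]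
    simp
  have h2 : Finset.Icc 1 l = Finset.Ico (0 + 1) (l + 1) := by ext; simp
  have h3 : ∑ c ∈ Finset.Ico (l + 2) (2 * l + 2), F (1 + c)
      = ∑ c ∈ Finset.Icc 1 l, F (1 - c) := by
    refine Finset.sum_bij' (fun c _ => 2 * l + 2 - c) (fun c _ => 2 * l + 2 - c) ?_ ?_ ?_ ?_ ?_
    · intro c hc; simp at hc ⊢; omega
    · intro c hc; simp at hc ⊢; omega
    · intro c hc; simp at hc ⊢; omega
    · intro c hc; simp at hc ⊢; omega
    · intro c hc
      simp only [Finset.mem_Ico] at hc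
      rw [Nat.cast_sub (by omega), ZMod.natCast_self]
      congr 1; ring
  rw [h1, ← Finset.sum_Ico_consecutive _ (Nat.zero_le (l + 1)) (by omega : l + 1 ≤ 2 * l + 2),
    Finset.sum_eq_sum_Ico_succ_bot (by omega : 0 < l + 1),
    Finset.sum_eq_sum_Ico_succ_bot (by omega : l + 1 < 2 * l + 2), h3, h2]
  have h4 : (1 : ZMod (2 * l + 2)) + ((l + 1 : ℕ) : ZMod (2 * l + 2)) = l + 2 := by
    push_cast; ring
  rw [h4]
  simp only [Nat.cast_zero, add_zero]
  abel

theorem val_add_one_eq {n : ℕ} [NeZero n] (c : ZMod n) :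
    (c + 1).val = if c + 1 = 0 then 0 else c.val + 1 := by
  split_ifs with h0
  · simp [h0]
  · have h1 : ((c.val + 1 : ℕ) : ZMod n) = c + 1 := by simp
    have h2 : c.val + 1 ≠ n := fun h => h0 (by rw [← h1, h, ZMod.natCast_self])
    have h3 := ZMod.val_lt c
    rw [← h1, ZMod.val_cast_of_lt (by omega)]

theorem val_add_one_eq_of_eq_zero {n : ℕ} [NeZero n] {c : ZMod n} (h0 : c + 1 = 0) :
    c.val + 1 = n := by
  have h1 : ((c.val + 1 : ℕ) : ZMod n) = 0 := by simpa using h0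
  have h2 := Nat.le_of_dvd (by omega) ((ZMod.natCast_eq_zero_iff _ _).1 h1)
  have h3 := ZMod.val_lt c
  omega

/-- A sawtooth has constant slope and one jump of height `n`. The jump isolates one summand in the
sums defining `β`. -/
theorem val_sub_val_add_one {n : ℕ} [NeZero n] (c : ZMod n) :
    (c.val : ℂ) - ((c + 1).val : ℂ) = -1 + if c + 1 = 0 then (n : ℂ) else 0 := by
  rw [val_add_one_eq]
  split_ifs with h0
  · have := val_add_one_eq_of_eq_zero h0
    have h1 : (c.val : ℂ) + 1 = n := by exact_mod_cast this
    rw [← h1]; push_cast; ring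
  · push_cast; ring

/-- The analogue for geometric weights; the jump `1 - s ^ n` is the denominator normalising `γ`. -/
theorem neg_mul_pow_val_add {n : ℕ} [NeZero n] (s : ℂ) (c : ZMod n) :
    s ^ (c + 1).val - s * s ^ c.val = if c + 1 = 0 then 1 - s ^ n else 0 := by
  rw [val_add_one_eq]
  split_ifs with h0
  · have := val_add_one_eq_of_eq_zero h0
    rw [← pow_succ', this, pow_zero]
  · rw [pow_succ']; ring

theorem val_neg_sub_one {n : ℕ} [NeZero n] (c : ZMod n) : (-c - 1).val + c.val + 1 = n := by
  have h1 : ((n - 1 - c.val : ℕ) : ZMod n) = -c - 1 := by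
    have := ZMod.val_lt c
    rw [Nat.sub_sub, Nat.cast_sub (by omega)]
    simp; ring
  have := ZMod.val_lt c
  rw [← h1, ZMod.val_cast_of_lt (by omega)]
  omega

/-- The sign `(-1) ^ c` of an index modulo `2 * l + 2`. -/
noncomputable def sgn {l : ℕ} (c : ZMod (2 * l + 2)) : ℂ := (-1) ^ c.val

/-- The modulus is even, so the parity of a residue is well defined. -/
theorem sgn_natCast {l : ℕ} (k : ℕ) : sgn (k : ZMod (2 * l + 2)) = (-1) ^ k := by
  rw [sgn, ZMod.val_natCast]
  conv_rhs => rw [← Nat.mod_add_div k (2 * l + 2)]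
  rw [pow_add, pow_mul, (by simp [parity_simps] : (-1 : ℂ) ^ (2 * l + 2) = 1)]
  simp

theorem sgn_add_one {l : ℕ} (c : ZMod (2 * l + 2)) : sgn (c + 1) = -sgn c := by
  have := sgn_natCast (l := l) (c.val + 1)
  rw [pow_succ] at this
  simpa [sgn] using this

theorem sgn_sub_one {l : ℕ} (c : ZMod (2 * l + 2)) : sgn (c - 1) = -sgn c := by
  rw [← neg_eq_iff_eq_neg, ← sgn_add_one, sub_add_cancel]

theorem sgn_mul_self {l : ℕ} (c : ZMod (2 * l + 2)) : sgn c * sgn c = 1 := by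
  rw [sgn, ← mul_pow]; simp

theorem conj_sgn {l : ℕ} (c : ZMod (2 * l + 2)) : starRingEnd ℂ (sgn c) = sgn c := by
  simp [sgn]

theorem sgn_neg {l : ℕ} (c : ZMod (2 * l + 2)) : sgn (-c) = sgn c := by
  have h1 := val_neg_sub_one c
  have h2 := sgn_sub_one (-c)
  have h3 : sgn (-c - 1) * sgn c = -1 := by
    rw [sgn, sgn, ← pow_add]
    have : Odd ((-c - 1).val + c.val) := ⟨l, by omega⟩
    exact this.neg_one_pow
  rw [h2] at h3
  linear_combination (-sgn c) * h3 - sgn (-c) * sgn_mul_self c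

theorem sgn_two_sub {l : ℕ} (c : ZMod (2 * l + 2)) : sgn (2 - c) = sgn c := by
  rw [show 2 - c = -c + 1 + 1 by ring, sgn_add_one, sgn_add_one, sgn_neg, neg_neg]

theorem sgn_one_sub {l : ℕ} (c : ZMod (2 * l + 2)) : sgn (1 - c) = -sgn c := by
  rw [show 1 - c = -c + 1 by ring, sgn_add_one, sgn_neg]

/-- A sum weighted by `(-1) ^ c` of a function symmetric under `c ↦ 1 - c` vanishes. -/
theorem sum_sgn_mul_eq_zero {l : ℕ} {F : ZMod (2 * l + 2) → ℂ} (hF : ∀ c, F (1 - c) = F c) :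
    ∑ c, sgn c * F c = 0 := by
  -- The reflection `c ↦ 1 - c` reverses parity, so the sum equals its own negative.
  have h1 := Equiv.sum_comp (Equiv.subLeft 1) fun c => sgn c * F c
  simp only [Equiv.subLeft_apply, sgn_one_sub, hF, neg_mul, Finset.sum_neg_distrib] at h1
  linear_combination (-1 / 2 : ℂ) * h1

/-- Summation by parts with the weights `(-1) ^ c {c - j - 1}`. -/
theorem sum_sgn_val_add {l : ℕ} {F : ZMod (2 * l + 2) → ℂ} (hF : ∀ c, F (1 - c) = F c)
    (j : ZMod (2 * l + 2)) :
    ∑ c, sgn c * ((c - j - 1).val : ℂ) * (F (c - 1) + F c) = (2 * l + 2) * (sgn j * F j) := by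
  have h1 := Equiv.sum_comp (Equiv.addRight 1) fun c : ZMod (2 * l + 2) =>
    sgn c * ((c - j - 1).val : ℂ) * F (c - 1)
  simp only [Equiv.coe_addRight, sgn_add_one, add_sub_cancel_right] at h1
  -- The slope of the sawtooth contributes an alternating sum that vanishes by symmetry; the jump
  -- contributes the term `c = j`.
  have h2 (c : ZMod (2 * l + 2)) : sgn c * ((c - j - 1).val : ℂ) * F c
      = -(sgn c * F c) + (if c = j then (2 * l + 2) * (sgn c * F c) else 0)
        - (-sgn c * ((c + 1 - j - 1).val : ℂ) * F c) := by
    have h3 := val_sub_val_add_one (c - j - 1)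
    rw [show c - j - 1 + 1 = c + 1 - j - 1 by ring,
      show c + 1 - j - 1 = c - j by ring] at h3
    simp only [sub_eq_zero] at h3
    rw [show c + 1 - j - 1 = c - j by ring]
    push_cast at h3
    split_ifs at h3 ⊢ <;> linear_combination (sgn c * F c) * h3
  simp only [mul_add, Finset.sum_add_distrib]
  rw [← h1, Finset.sum_congr rfl fun c _ => h2 c, Finset.sum_sub_distrib, Finset.sum_add_distrib,
    Finset.sum_neg_distrib, sum_sgn_mul_eq_zero hF, Finset.sum_ite_eq' Finset.univ j]
  simp

open scoped ComplexConjugate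

/-! ### The exponents -/

section Exponent

variable {l : ℕ} (u : ℕ → ℂ → ℝ)

theorem exponent_one_add {k : ℕ} (h1 : 1 ≤ k) (h2 : k ≤ l) (p : ℂ) :
    exponent l u (1 + k) p = u k p := by
  have hk : (1 + (k : ZMod (2 * l + 2)) - 1).val = k := by
    rw [add_sub_cancel_left, ZMod.val_cast_of_lt (by omega)]
  simp only [exponent, hk]
  rw [if_neg (by omega), if_pos h2]

theorem exponent_one (p : ℂ) : exponent l u 1 p = 0 := by simp [exponent]

theorem exponent_natCast_add_two (p : ℂ) : exponent l u (l + 2) p = 0 := by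
  have hk : ((l : ZMod (2 * l + 2)) + 2 - 1).val = l + 1 := by
    have : (l : ZMod (2 * l + 2)) + 2 - 1 = ((l + 1 : ℕ) : ZMod (2 * l + 2)) := by push_cast; ring
    rw [this, ZMod.val_cast_of_lt (by omega)]
  simp only [exponent, hk]
  simp

/-- This symmetry cancels the derivatives of `u` in the products `h_{2-c} h_c`. -/
theorem exponent_two_sub (c : ZMod (2 * l + 2)) (p : ℂ) :
    exponent l u (2 - c) p = -exponent l u c p := by
  have h1 : 2 - c - 1 = -(c - 1) := by ring
  have h2 := ZMod.val_lt (c - 1)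
  simp only [exponent, h1, ZMod.neg_val]
  by_cases h0 : c - 1 = 0
  · simp [h0]
  · have h3 : (c - 1).val ≠ 0 := by rwa [ne_eq, ZMod.val_eq_zero]
    rw [if_neg h0, if_neg (by omega), if_neg h3]
    rcases lt_trichotomy (c - 1).val (l + 1) with h | h | h
    · rw [if_neg (by omega), if_neg (by omega), if_pos (by omega),
        show 2 * l + 2 - (2 * l + 2 - (c - 1).val) = (c - 1).val by omega]
    · rw [if_neg (by omega), if_pos (by omega), if_neg (by omega), if_pos (by omega), neg_zero]
    · rw [if_pos (by omega), if_neg (by omega), if_neg (by omega), neg_neg]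

theorem exponent_one_sub {k : ℕ} (h1 : 1 ≤ k) (h2 : k ≤ l) (p : ℂ) :
    exponent l u (1 - k) p = -u k p := by
  rw [show (1 : ZMod (2 * l + 2)) - k = 2 - (1 + k) by ring, exponent_two_sub,
    exponent_one_add u h1 h2]

theorem contDiffOn_exponent {u : ℕ → ℂ → ℝ} {U : Set ℂ}
    (hu : ∀ j, 1 ≤ j → j ≤ l → ContDiffOn ℝ 2 (u j) U) (c : ZMod (2 * l + 2)) :
    ContDiffOn ℝ 2 (exponent l u c) U := by
  have h2 := ZMod.val_lt (c - 1)
  unfold exponent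
  dsimp only
  split_ifs with h3 h4 h5
  · exact contDiffOn_const
  · exact hu _ (by omega) h4
  · exact contDiffOn_const
  · exact (hu _ (by omega) (by omega)).neg

/-- The diagonal entry `e^{w_c}` of `V`, where `w_c` is the exponent. -/
noncomputable def expV (l : ℕ) (u : ℕ → ℂ → ℝ) (c : ZMod (2 * l + 2)) (p : ℂ) : ℂ :=
  (Real.exp (exponent l u c p) : ℂ)

/-- The derivative `∂_z w_c` of an exponent. -/
noncomputable def dzExponent (l : ℕ) (u : ℕ → ℂ → ℝ) (c : ZMod (2 * l + 2)) (p : ℂ) : ℂ :=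
  dz (fun q => (exponent l u c q : ℂ)) p

theorem expV_ne_zero (c : ZMod (2 * l + 2)) (p : ℂ) : expV l u c p ≠ 0 := by
  simp only [expV, ne_eq, Complex.ofReal_eq_zero]
  exact Real.exp_ne_zero _

theorem conj_expV (c : ZMod (2 * l + 2)) (p : ℂ) : conj (expV l u c p) = expV l u c p :=
  Complex.conj_ofReal _

theorem expV_two_sub (c : ZMod (2 * l + 2)) (p : ℂ) :
    expV l u (2 - c) p = (expV l u c p)⁻¹ := by
  rw [expV, exponent_two_sub, Real.exp_neg, Complex.ofReal_inv, expV]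

theorem expV_one_sub (c : ZMod (2 * l + 2)) (p : ℂ) :
    expV l u (1 - c) p = (expV l u (c + 1) p)⁻¹ := by
  rw [← expV_two_sub]; congr 1; ring

end Exponent

theorem HasWirt.eq_conj {r : ℂ → ℝ} {a b p : ℂ} (hr : HasWirt (fun q => (r q : ℂ)) a b p) :
    b = conj a := by
  have h1 := hr.conj
  simp only [Complex.conj_ofReal] at h1
  rw [← hr.dzbar_eq, h1.dzbar_eq]

theorem hasWirt_exponent {l : ℕ} {U : Set ℂ} (hU : IsOpen U) {u : ℕ → ℂ → ℝ}
    (hu : ∀ j, 1 ≤ j → j ≤ l → ContDiffOn ℝ 2 (u j) U) (c : ZMod (2 * l + 2)) {p : ℂ}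
    (hp : p ∈ U) :
    HasWirt (fun q => (exponent l u c q : ℂ)) (dzExponent l u c p) (conj (dzExponent l u c p)) p := by
  have h1 : DifferentiableAt ℝ (fun q => (exponent l u c q : ℂ)) p :=
    Complex.ofRealCLM.differentiableAt.comp p
      (((contDiffOn_exponent hu c).contDiffAt (hU.mem_nhds hp)).differentiableAt (by norm_num))
  have h2 := hasWirt_of_differentiableAt h1
  exact h2.congr_coeff rfl h2.eq_conj

theorem hasWirt_expV {l : ℕ} {U : Set ℂ} (hU : IsOpen U) {u : ℕ → ℂ → ℝ}
    (hu : ∀ j, 1 ≤ j → j ≤ l → ContDiffOn ℝ 2 (u j) U) (c : ZMod (2 * l + 2)) {p : ℂ}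
    (hp : p ∈ U) :
    HasWirt (expV l u c) (expV l u c p * dzExponent l u c p)
      (expV l u c p * conj (dzExponent l u c p)) p :=
  (hasWirt_exponent hU hu c hp).real_comp (Real.hasDerivAt_exp _)

/-! ### The Lax pair in components -/

section Lax

variable {l : ℕ} {U : Set ℂ} {u : ℕ → ℂ → ℝ} {μ : ℂ} {h : ZMod (2 * l + 2) → ℂ → ℂ}

theorem V_inv (p : ℂ) : (V l u p)⁻¹ = Matrix.diagonal fun c => (expV l u c p)⁻¹ := by
  rw [V]
  refine Matrix.inv_eq_left_inv ?_
  rw [Matrix.diagonal_mul_diagonal, ← Matrix.diagonal_one]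
  congr 1
  funext c
  exact inv_mul_cancel₀ (expV_ne_zero u c p)

theorem IsLaxSolution.hasWirt (hh : IsLaxSolution l U u μ h) (hU : IsOpen U)
    (hu : ∀ j, 1 ≤ j → j ≤ l → ContDiffOn ℝ 2 (u j) U) (c : ZMod (2 * l + 2)) {p : ℂ}
    (hp : p ∈ U) :
    HasWirt (h c) (μ * h (c + 1) p + dzExponent l u c p * h c p)
      (μ⁻¹ * (expV l u c p / expV l u (c - 1) p) * h (c - 1) p) p := by
  have hJ (k : ZMod (2 * l + 2) → ℂ) : (J l).mulVec k c = k (c + 1) := by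
    simp [J, Matrix.mulVec, dotProduct]
  have hJt (k : ZMod (2 * l + 2) → ℂ) : (J l).transpose.mulVec k c = k (c - 1) := by
    simp [J, Matrix.mulVec, dotProduct, ← eq_sub_iff_add_eq]
  have hP : P l u p = Matrix.diagonal (dzExponent l u · p) := by
    rw [P, V_inv]
    ext a b
    rw [Matrix.mul_diagonal]
    rcases eq_or_ne a b with rfl | hab
    · simp only [Matrix.of_apply, V, Matrix.diagonal_apply_eq]
      change dz (expV l u a) p * (expV l u a p)⁻¹ = dzExponent l u a p
      rw [(hasWirt_expV hU hu a hp).dz_eq]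
      field_simp [expV_ne_zero u a p]
    · simp only [Matrix.of_apply, V, Matrix.diagonal_apply_ne _ hab,
        (HasWirt.const 0 p).dz_eq, zero_mul]
  have h1 := hh.eq_dz p hp c
  have h2 := hh.eq_dzbar p hp c
  rw [Matrix.add_mulVec, Matrix.smul_mulVec, Pi.add_apply, Pi.smul_apply, hJ, hP,
    Matrix.mulVec_diagonal] at h1
  rw [Matrix.smul_mulVec, Pi.smul_apply, Q, V_inv, ← Matrix.mulVec_mulVec, ← Matrix.mulVec_mulVec,
    V, Matrix.mulVec_diagonal, hJt, Matrix.mulVec_diagonal] at h2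
  refine (hasWirt_of_differentiableAt
    ((hh.differentiableOn c).differentiableAt (hU.mem_nhds hp))).congr_coeff h1 (h2.trans ?_)
  simp only [smul_eq_mul, expV]
  ring

/-- Bootstrapping: the derivatives of `h` are combinations of `h` with coefficients of class at
least `C¹`, so regularity rises from continuity to `C¹` and then to `C²`. -/
theorem IsLaxSolution.contDiffOn (hh : IsLaxSolution l U u μ h) (hU : IsOpen U)
    (hu : ∀ j, 1 ≤ j → j ≤ l → ContDiffOn ℝ 2 (u j) U) (c : ZMod (2 * l + 2)) :
    ContDiffOn ℝ 2 (h c) U := by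
  have hE (c : ZMod (2 * l + 2)) : ContDiffOn ℝ 2 (expV l u c) U :=
    Complex.ofRealCLM.contDiff.comp_contDiffOn (contDiffOn_exponent hu c).exp
  have hR (c : ZMod (2 * l + 2)) :
      ContDiffOn ℝ 2 (fun p => expV l u c p / expV l u (c - 1) p) U := by
    simp only [div_eq_mul_inv]
    exact (hE c).mul ((hE (c - 1)).inv fun p _ => expV_ne_zero u _ p)
  have hW (c : ZMod (2 * l + 2)) : ContDiffOn ℝ 1 (dzExponent l u c) U :=
    contDiffOn_dz (n := 1) hU
      ((Complex.ofRealCLM.contDiff.comp_contDiffOn (contDiffOn_exponent hu c)).of_le (by norm_num))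
  have step (n : ℕ) (hn : n ≤ 1) (hc : ∀ c, ContDiffOn ℝ n (h c) U) (c) :
      ContDiffOn ℝ (n + 1) (h c) U := by
    have hn1 : (n : WithTop ℕ∞) ≤ 1 := by exact_mod_cast hn
    refine contDiffOn_succ_of_hasWirt hU (fun p hp => hh.hasWirt hU hu c hp) ?_ ?_
    · exact (contDiffOn_const.mul (hc _)).add (((hW c).of_le hn1).mul (hc c))
    · exact (contDiffOn_const.mul ((hR c).of_le (hn1.trans (by norm_num)))).mul (hc _)
  have h0 (c) : ContDiffOn ℝ (0 : ℕ) (h c) U := by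
    simpa using (hh.differentiableOn c).continuousOn
  have h1 (c) : ContDiffOn ℝ (1 : ℕ) (h c) U := by simpa using step 0 (by norm_num) h0 c
  have h2 := step 1 le_rfl h1 c
  exact h2.of_le (by norm_num)

end Lax

/-! ### The functions `γ_j` -/

section Gamma

variable {l : ℕ} {U : Set ℂ} {u : ℕ → ℂ → ℝ} {μ : ℂ} {h : ZMod (2 * l + 2) → ℂ → ℂ}

theorem one_sub_pow_ne_zero (hμ1 : ‖μ‖ ≠ 1) : 1 - (-(μ * conj μ)) ^ (2 * l + 2) ≠ 0 := by
  rw [Complex.mul_conj', Even.neg_pow (by simp [parity_simps]), ← pow_mul, sub_ne_zero]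
  intro h1
  have h2 : ‖μ‖ ^ (2 * (2 * l + 2)) = 1 := by exact_mod_cast h1.symm
  exact hμ1 ((pow_eq_one_iff_of_nonneg (norm_nonneg μ) (by omega)).1 h2)

theorem ofReal_γ (j : ZMod (2 * l + 2)) (p : ℂ) :
    (γ l u μ h j p : ℂ) = 1 / (1 - (-(μ * conj μ)) ^ (2 * l + 2)) *
      ∑ c, (-(μ * conj μ)) ^ (j + c - 2).val * (h c p * conj (h c p) / expV l u c p) := by
  have h0 : (-(‖μ‖ : ℂ) ^ 2) ^ (2 * l + 2) = (‖μ‖ : ℂ) ^ (4 * l + 4) := by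
    rw [Even.neg_pow (by simp [parity_simps]), ← pow_mul]; congr 1; ring
  rw [sum_zmod_split, γ]
  simp only [Complex.mul_conj', h0]
  push_cast
  congr 1
  congr 1
  · congr 1
    · congr 1
      · rw [expV, exponent_one, show j + 1 - 2 = j - 1 by ring]; simp
      · rw [expV, exponent_natCast_add_two,
          show j + ((l : ZMod (2 * l + 2)) + 2) - 2 = j + l by ring]
        simp
    · refine Finset.sum_congr rfl fun c hc => ?_
      rw [Finset.mem_Icc] at hc
      rw [expV, exponent_one_add u hc.1 hc.2,
        show j + (1 + (c : ZMod (2 * l + 2))) - 2 = j + c - 1 by ring]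
      push_cast
      rw [Complex.exp_neg]
      ring
  · refine Finset.sum_congr rfl fun c hc => ?_
    rw [Finset.mem_Icc] at hc
    rw [expV, exponent_one_sub u hc.1 hc.2,
      show j + (1 - (c : ZMod (2 * l + 2))) - 2 = j - c - 1 by ring]
    push_cast
    rw [Complex.exp_neg]
    field_simp

/-- Summation by parts: after a shift, `F c` has coefficient `s^{j+c-1} - s · s^{j+c-2}` with
reduced exponents, which vanishes unless the exponent wraps, at `c = 1 - j`. -/
theorem sum_pow_val_mul_sub (s : ℂ) (F : ZMod (2 * l + 2) → ℂ) (j : ZMod (2 * l + 2)) :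
    ∑ c, s ^ (j + c - 2).val * (F (c - 1) - s * F c) = (1 - s ^ (2 * l + 2)) * F (1 - j) := by
  have h1 := Equiv.sum_comp (Equiv.addRight 1) fun c : ZMod (2 * l + 2) =>
    s ^ (j + c - 2).val * F (c - 1)
  simp only [Equiv.coe_addRight, add_sub_cancel_right] at h1
  simp only [mul_sub, Finset.sum_sub_distrib]
  rw [← h1, ← Finset.sum_sub_distrib, Finset.sum_eq_single (1 - j)]
  · have h2 := neg_mul_pow_val_add s (-1 : ZMod (2 * l + 2))
    rw [show j + (1 - j + 1) - 2 = 0 by ring, show j + (1 - j) - 2 = -1 by ring]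
    simp only [neg_add_cancel, if_true] at h2
    linear_combination F (1 - j) * h2
  · intro c _ hc
    have h2 := neg_mul_pow_val_add s (j + c - 2)
    have h3 : j + c - 2 + 1 ≠ 0 := fun h3 => hc (by linear_combination h3)
    rw [if_neg h3, show j + c - 2 + 1 = j + (c + 1) - 2 by ring] at h2
    linear_combination F c * h2
  · simp

theorem γ_sub_one (hμ1 : ‖μ‖ ≠ 1) (j : ZMod (2 * l + 2)) (p : ℂ) :
    (γ l u μ h j p : ℂ) + μ * conj μ * γ l u μ h (j - 1) p
      = h (2 - j) p * conj (h (2 - j) p) / expV l u (2 - j) p := by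
  have h1 := sum_pow_val_mul_sub (-(μ * conj μ))
    (fun c => h (c + 1) p * conj (h (c + 1) p) / expV l u (c + 1) p) j
  have h2 := Equiv.sum_comp (Equiv.addRight 1) fun c : ZMod (2 * l + 2) =>
    (-(μ * conj μ)) ^ (j - 1 + c - 2).val * (h c p * conj (h c p) / expV l u c p)
  have h3 := one_sub_pow_ne_zero (l := l) hμ1
  simp only [Equiv.coe_addRight] at h2
  simp only [sub_add_cancel, mul_sub, Finset.sum_sub_distrib, show 1 - j + 1 = 2 - j by ring,
    mul_left_comm _ (-(μ * conj μ)) _, ← Finset.mul_sum] at h1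
  simp only [fun c => show j - 1 + (c + 1) - 2 = j + c - 2 by ring] at h2
  rw [ofReal_γ, ofReal_γ, ← h2]
  linear_combination (1 / (1 - (-(μ * conj μ)) ^ (2 * l + 2))) * h1
    + (h (2 - j) p * conj (h (2 - j) p) / expV l u (2 - j) p) * one_div_mul_cancel h3

theorem hasWirt_γ (hμ : μ ≠ 0) (hμ1 : ‖μ‖ ≠ 1) (hh : IsLaxSolution l U u μ h) (hU : IsOpen U)
    (hu : ∀ j, 1 ≤ j → j ≤ l → ContDiffOn ℝ 2 (u j) U) (j : ZMod (2 * l + 2)) {p : ℂ}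
    (hp : p ∈ U) :
    HasWirt (fun q => (γ l u μ h j q : ℂ))
      ((conj μ)⁻¹ * (h (2 - j) p * conj (h (1 - j) p) * expV l u (j + 1) p))
      (μ⁻¹ * (conj (h (2 - j) p) * h (1 - j) p * expV l u (j + 1) p)) p := by
  have hμc : conj μ ≠ 0 := by simpa using hμ
  have h3 := one_sub_pow_ne_zero (l := l) hμ1
  set b : ZMod (2 * l + 2) → ℂ := fun c => h (c + 1) p * conj (h c p) / expV l u c p with hb
  -- Division by `V_c` removes the potential term of the Lax pair, leaving the difference `b_{c-1} -
  -- s b_c` that telescopes.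
  have hA (c : ZMod (2 * l + 2)) : HasWirt (fun q => h c q * conj (h c q) / expV l u c q)
      ((conj μ)⁻¹ * (b (c - 1) - -(μ * conj μ) * b c))
      (conj ((conj μ)⁻¹ * (b (c - 1) - -(μ * conj μ) * b c))) p := by
    have e0 := expV_ne_zero u c p
    have e1 := expV_ne_zero u (c - 1) p
    refine (((hh.hasWirt hU hu c hp).mul (hh.hasWirt hU hu c hp).conj).div
      (hasWirt_expV hU hu c hp) e0).congr_coeff ?_ ?_
    · simp only [hb, map_mul, map_div₀, map_inv₀, conj_expV, sub_add_cancel]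
      field_simp
      ring
    · simp only [hb, map_mul, map_div₀, map_inv₀, conj_expV, sub_add_cancel, map_add, map_sub,
        map_neg, Complex.conj_conj]
      field_simp
      ring
  have hs := (HasWirt.sum Finset.univ fun c _ =>
    (hA c).const_mul ((-(μ * conj μ)) ^ (j + c - 2).val)).const_mul
      (1 / (1 - (-(μ * conj μ)) ^ (2 * l + 2)))
  simp only [← ofReal_γ] at hs
  have hz : 1 / (1 - (-(μ * conj μ)) ^ (2 * l + 2)) * ∑ c, (-(μ * conj μ)) ^ (j + c - 2).val *
      ((conj μ)⁻¹ * (b (c - 1) - -(μ * conj μ) * b c))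
      = (conj μ)⁻¹ * (h (2 - j) p * conj (h (1 - j) p) * expV l u (j + 1) p) := by
    simp only [mul_left_comm _ (conj μ)⁻¹ _]
    rw [← Finset.mul_sum, sum_pow_val_mul_sub]
    simp only [hb, show 1 - j + 1 = 2 - j by ring, expV_one_sub]
    have e0 := expV_ne_zero u (j + 1) p
    field_simp
  refine hs.congr_coeff hz (hs.eq_conj.trans ?_)
  rw [hz]
  simp only [map_mul, map_inv₀, conj_expV, Complex.conj_conj]

theorem contDiffOn_γ (hh : IsLaxSolution l U u μ h) (hU : IsOpen U)
    (hu : ∀ j, 1 ≤ j → j ≤ l → ContDiffOn ℝ 2 (u j) U) (j : ZMod (2 * l + 2)) :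
    ContDiffOn ℝ 2 (γ l u μ h j) U := by
  have hn (c) : ContDiffOn ℝ 2 (fun p => ‖h c p‖ ^ 2) U := (hh.contDiffOn hU hu c).norm_sq ℝ
  unfold γ
  refine contDiffOn_const.mul ((((contDiffOn_const.mul (hn _)).add
    (contDiffOn_const.mul (hn _))).add (ContDiffOn.sum fun c hc => ?_)).add
    (ContDiffOn.sum fun c hc => ?_))
  · rw [Finset.mem_Icc] at hc
    exact (contDiffOn_const.mul (hn _)).mul (hu c hc.1 hc.2).neg.exp
  · rw [Finset.mem_Icc] at hc
    exact (contDiffOn_const.mul (hn _)).mul (hu c hc.1 hc.2).exp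

end Gamma

/-! ### The functions `β_j` -/

section Beta

variable {l : ℕ} {U : Set ℂ} {u : ℕ → ℂ → ℝ} {μ : ℂ} {h : ZMod (2 * l + 2) → ℂ → ℂ}

/-- The function `β_j = (2l+2)⁻¹ ∑_c (-1)^c {c-j-1} h_{2-c} h_c`. -/
noncomputable def β (l : ℕ) (h : ZMod (2 * l + 2) → ℂ → ℂ) (j : ZMod (2 * l + 2)) (p : ℂ) : ℂ :=
  1 / (2 * (l : ℂ) + 2) * ∑ c, sgn c * ((c - j - 1).val : ℂ) * (h (2 - c) p * h c p)

theorem two_mul_add_two_ne_zero (l : ℕ) : 2 * (l : ℂ) + 2 ≠ 0 := by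
  exact_mod_cast Nat.succ_ne_zero (2 * l + 1)

theorem g_eq (j : ZMod (2 * l + 2)) (p : ℂ) :
    g l u μ h j p = ‖β l h j p‖ ^ 2 - ‖μ‖ ^ 2 * γ l u μ h j p * γ l u μ h (1 - j) p := by
  have h1 := sum_Icc_eq_sum_zmod (n := 2 * l + 2) fun c =>
    sgn c * ((c - j - 1).val : ℂ) * (h (2 - c) p * h c p)
  simp only [sgn_natCast, ← mul_assoc] at h1
  have h2 : ‖1 / (2 * (l : ℂ) + 2)‖ = 1 / (2 * (l : ℝ) + 2) := by
    have : 1 / (2 * (l : ℂ) + 2) = ((1 / (2 * (l : ℝ) + 2) : ℝ) : ℂ) := by push_cast; rfl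
    rw [this, Complex.norm_real, Real.norm_of_nonneg (by positivity)]
  rw [g, β, norm_mul, mul_pow, h2, h1, one_div_pow]
  simp only [mul_assoc]

theorem ofReal_g (j : ZMod (2 * l + 2)) (p : ℂ) :
    (g l u μ h j p : ℂ) = β l h j p * conj (β l h j p)
      - μ * conj μ * (γ l u μ h j p * γ l u μ h (1 - j) p) := by
  rw [g_eq, Complex.mul_conj', Complex.mul_conj']
  push_cast
  ring

/-- The constraint of the Darboux transform as a sum over all indices. -/
theorem sum_sgn_of_constraint {p : ℂ}
    (hc : h 1 p ^ 2 + (-1 : ℂ) ^ (l + 1) * h ((l : ZMod (2 * l + 2)) + 2) p ^ 2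
        + 2 * ∑ c ∈ Finset.Icc 2 (l + 1),
            (-1 : ℂ) ^ (c - 1) * h (c : ZMod (2 * l + 2)) p
              * h (2 - (c : ZMod (2 * l + 2))) p = 0) :
    ∑ c, sgn c * (h (2 - c) p * h c p) = 0 := by
  -- The reflection `c ↦ 2 - c` fixes `1` and `l + 2`, which give the squares, and pairs the other
  -- indices, which gives the factor 2.
  have hl : (2 : ZMod (2 * l + 2)) - (l + 2) = l + 2 := by
    have := ZMod.natCast_self (2 * l + 2)
    push_cast at this
    linear_combination -this
  have h1 : sgn (1 : ZMod (2 * l + 2)) = -1 := by simpa using sgn_natCast (l := l) 1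
  have h2 : sgn ((l : ZMod (2 * l + 2)) + 2) = (-1) ^ l := by
    have := sgn_natCast (l := l) (l + 2)
    push_cast at this
    rw [this, pow_add]; ring
  have h3 : ∑ c ∈ Finset.Icc 2 (l + 1), (-1 : ℂ) ^ (c - 1) * h (c : ZMod (2 * l + 2)) p
      * h (2 - (c : ZMod (2 * l + 2))) p
      = ∑ c ∈ Finset.Icc 1 l, (-1 : ℂ) ^ c * (h (1 - c) p * h (1 + c) p) := by
    refine Finset.sum_bij' (fun c _ => c - 1) (fun c _ => c + 1) ?_ ?_ ?_ ?_ ?_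
    · intro c hc; simp at hc ⊢; omega
    · intro c hc; simp at hc ⊢; omega
    · intro c hc; simp at hc ⊢; omega
    · intro c hc; simp
    · intro c hc
      simp only [Finset.mem_Icc] at hc
      have : ((c - 1 : ℕ) : ZMod (2 * l + 2)) = c - 1 := by rw [Nat.cast_sub (by omega)]; simp
      rw [this, show (1 : ZMod (2 * l + 2)) - (c - 1) = 2 - c by ring,
        show (1 : ZMod (2 * l + 2)) + (c - 1) = c by ring]
      ring
  have h4 (c : ℕ) : sgn (1 + (c : ZMod (2 * l + 2))) = -(-1) ^ c := by
    rw [add_comm, sgn_add_one, sgn_natCast]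
  have h5 (c : ℕ) : sgn (1 - (c : ZMod (2 * l + 2))) = -(-1) ^ c := by
    rw [sgn_one_sub, sgn_natCast]
  rw [h3] at hc
  rw [sum_zmod_split, h1, h2, hl, show (2 : ZMod (2 * l + 2)) - 1 = 1 by ring]
  simp only [h4, h5, fun c : ZMod (2 * l + 2) => show 2 - (1 + c) = 1 - c by ring,
    fun c : ZMod (2 * l + 2) => show 2 - (1 - c) = 1 + c by ring, neg_mul, Finset.sum_neg_distrib,
    mul_comm (h (1 + _) p) (h (1 - _) p)]
  rw [pow_succ] at hc
  linear_combination -hc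

/-- Passing from `j` to `j - 1` changes the weight by a constant, killed by the constraint, and by a
jump at `c = j`. -/
theorem β_sub_one {p : ℂ} (hc : ∑ c, sgn c * (h (2 - c) p * h c p) = 0) (j : ZMod (2 * l + 2)) :
    β l h j p - β l h (j - 1) p = sgn j * (h (2 - j) p * h j p) := by
  have hl := two_mul_add_two_ne_zero l
  have h2 (c : ZMod (2 * l + 2)) :
      sgn c * ((c - j - 1).val : ℂ) * (h (2 - c) p * h c p)
        - sgn c * ((c - (j - 1) - 1).val : ℂ) * (h (2 - c) p * h c p)
      = -(sgn c * (h (2 - c) p * h c p))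
        + if c = j then (2 * l + 2) * (sgn c * (h (2 - c) p * h c p)) else 0 := by
    have h3 := val_sub_val_add_one (c - j - 1)
    rw [sub_add_cancel] at h3
    simp only [sub_eq_zero] at h3
    rw [show c - (j - 1) - 1 = c - j by ring]
    push_cast at h3
    split_ifs at h3 ⊢ <;> linear_combination (sgn c * (h (2 - c) p * h c p)) * h3
  rw [β, β, ← mul_sub, ← Finset.sum_sub_distrib, Finset.sum_congr rfl fun c _ => h2 c,
    Finset.sum_add_distrib, Finset.sum_neg_distrib, hc, Finset.sum_ite_eq' Finset.univ j]
  simp only [Finset.mem_univ, if_true]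
  field_simp
  ring

/-- Under `c ↦ 2 - c` the weight `{k}` becomes `N - 1 - {k}`, and the constraint removes the
constant. -/
theorem β_one_sub {p : ℂ} (hc : ∑ c, sgn c * (h (2 - c) p * h c p) = 0) (j : ZMod (2 * l + 2)) :
    β l h (1 - j) p = -β l h j p := by
  have h1 := Equiv.sum_comp (Equiv.subLeft 2) fun c : ZMod (2 * l + 2) =>
    sgn c * ((c - (1 - j) - 1).val : ℂ) * (h (2 - c) p * h c p)
  have h2 (c : ZMod (2 * l + 2)) :
      sgn c * ((2 - c - (1 - j) - 1).val : ℂ) * (h c p * h (2 - c) p)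
        = (2 * l + 1) * (sgn c * (h (2 - c) p * h c p))
          - sgn c * ((c - j - 1).val : ℂ) * (h (2 - c) p * h c p) := by
    have h3 := val_neg_sub_one (c - j - 1)
    rw [show -(c - j - 1) - 1 = 2 - c - (1 - j) - 1 by ring] at h3
    have h4 : ((2 - c - (1 - j) - 1).val : ℂ) + ((c - j - 1).val : ℂ) + 1 = 2 * l + 2 := by
      exact_mod_cast h3
    linear_combination (sgn c * (h (2 - c) p * h c p)) * h4
  simp only [Equiv.subLeft_apply, sgn_two_sub, sub_sub_cancel] at h1
  rw [β, β, ← h1, Finset.sum_congr rfl fun c _ => h2 c, Finset.sum_sub_distrib, ← Finset.mul_sum,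
    hc]
  ring

theorem hasWirt_β (hh : IsLaxSolution l U u μ h) (hU : IsOpen U)
    (hu : ∀ j, 1 ≤ j → j ≤ l → ContDiffOn ℝ 2 (u j) U) (j : ZMod (2 * l + 2)) {p : ℂ}
    (hp : p ∈ U) :
    HasWirt (β l h j) (μ * (sgn j * (h (2 - j) p * h (j + 1) p)))
      (μ⁻¹ * (sgn j * (expV l u (j + 1) p / expV l u j p * (h (1 - j) p * h j p)))) p := by
  have hl := two_mul_add_two_ne_zero l
  set d : ZMod (2 * l + 2) → ℂ := fun c => h (2 - c) p * h (c + 1) p with hd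
  set k : ZMod (2 * l + 2) → ℂ := fun c =>
    expV l u (c + 1) p / expV l u c p * (h (1 - c) p * h c p) with hk
  have hds (c) : d (1 - c) = d c := by
    simp only [hd]
    rw [show 2 - (1 - c) = c + 1 by ring, show 1 - c + 1 = 2 - c by ring, mul_comm]
  have hks (c) : k (1 - c) = k c := by
    simp only [hk]
    rw [show 1 - c + 1 = 2 - c by ring, sub_sub_cancel, expV_two_sub, expV_one_sub]
    have e0 := expV_ne_zero u c p
    have e1 := expV_ne_zero u (c + 1) p
    field_simp
  -- Each derivative is a sum of neighbouring values of a function symmetric under `c ↦ 1 - c`, as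
  -- `sum_sgn_val_add` requires.
  have hA (c : ZMod (2 * l + 2)) : HasWirt (fun q => h (2 - c) q * h c q)
      (μ * (d (c - 1) + d c)) (μ⁻¹ * (k (c - 1) + k c)) p := by
    have e0 := expV_ne_zero u c p
    have e1 := expV_ne_zero u (c - 1) p
    have e2 := expV_ne_zero u (c + 1) p
    have hW : dzExponent l u (2 - c) p = -dzExponent l u c p := by
      have := (hasWirt_exponent hU hu c hp).neg
      simp only [← Complex.ofReal_neg, ← exponent_two_sub] at this
      rw [dzExponent, this.dz_eq]
    refine ((hh.hasWirt hU hu (2 - c) hp).mul (hh.hasWirt hU hu c hp)).congr_coeff ?_ ?_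
    · simp only [hd]
      rw [hW, show 2 - c + 1 = 2 - (c - 1) by ring, sub_add_cancel]
      ring
    · simp only [hk]
      rw [show 1 - (c - 1) = 2 - c by ring, sub_add_cancel, show 2 - c - 1 = 1 - c by ring,
        expV_two_sub, expV_one_sub]
      field_simp
      ring
  have hs := (HasWirt.sum Finset.univ fun c _ =>
    (hA c).const_mul (sgn c * ((c - j - 1).val : ℂ))).const_mul (1 / (2 * (l : ℂ) + 2))
  refine hs.congr_coeff ?_ ?_
  · simp only [mul_left_comm _ μ _]
    rw [← Finset.mul_sum, sum_sgn_val_add hds]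
    field_simp
    simp only [hd]
    ring
  · simp only [mul_left_comm _ μ⁻¹ _]
    rw [← Finset.mul_sum, sum_sgn_val_add hks]
    simp only [hk]
    field_simp

theorem contDiffOn_β (hh : IsLaxSolution l U u μ h) (hU : IsOpen U)
    (hu : ∀ j, 1 ≤ j → j ≤ l → ContDiffOn ℝ 2 (u j) U) (j : ZMod (2 * l + 2)) :
    ContDiffOn ℝ 2 (β l h j) U :=
  contDiffOn_const.mul (ContDiffOn.sum fun c _ => contDiffOn_const.mul
    ((hh.contDiffOn hU hu (2 - c)).mul (hh.contDiffOn hU hu c)))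

end Beta

/-! ### The bilinear identity -/

section Bilinear

variable {l : ℕ} {U : Set ℂ} {u : ℕ → ℂ → ℝ} {μ : ℂ} {h : ZMod (2 * l + 2) → ℂ → ℂ}

/-- The derivative `∂_z g_j`. -/
noncomputable def dzg (l : ℕ) (u : ℕ → ℂ → ℝ) (μ : ℂ) (h : ZMod (2 * l + 2) → ℂ → ℂ)
    (j : ZMod (2 * l + 2)) (p : ℂ) : ℂ :=
  μ * (sgn j * (h (2 - j) p * h (j + 1) p)) * conj (β l h j p)
    + (conj μ)⁻¹ * (sgn j * (expV l u (j + 1) p / expV l u j p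
        * (conj (h (1 - j) p) * conj (h j p)))) * β l h j p
    - μ * (h (2 - j) p * conj (h (1 - j) p) * expV l u (j + 1) p * γ l u μ h (1 - j) p
        + h (j + 1) p * conj (h j p) / expV l u j p * γ l u μ h j p)

theorem hasWirt_γ_one_sub (hμ : μ ≠ 0) (hμ1 : ‖μ‖ ≠ 1) (hh : IsLaxSolution l U u μ h)
    (hU : IsOpen U) (hu : ∀ j, 1 ≤ j → j ≤ l → ContDiffOn ℝ 2 (u j) U) (j : ZMod (2 * l + 2)) {p : ℂ}
    (hp : p ∈ U) :
    HasWirt (fun q => (γ l u μ h (1 - j) q : ℂ))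
      ((conj μ)⁻¹ * (h (j + 1) p * conj (h j p) / expV l u j p))
      (μ⁻¹ * (conj (h (j + 1) p) * h j p / expV l u j p)) p := by
  have h1 := hasWirt_γ hμ hμ1 hh hU hu (1 - j) hp
  simp only [show 2 - (1 - j) = j + 1 by ring, sub_sub_cancel, show 1 - j + 1 = 2 - j by ring,
    expV_two_sub, ← div_eq_mul_inv] at h1
  exact h1

theorem hasWirt_g (hμ : μ ≠ 0) (hμ1 : ‖μ‖ ≠ 1) (hh : IsLaxSolution l U u μ h) (hU : IsOpen U)
    (hu : ∀ j, 1 ≤ j → j ≤ l → ContDiffOn ℝ 2 (u j) U) (j : ZMod (2 * l + 2)) {p : ℂ}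
    (hp : p ∈ U) :
    HasWirt (fun q => (g l u μ h j q : ℂ)) (dzg l u μ h j p) (conj (dzg l u μ h j p)) p := by
  have hμc : conj μ ≠ 0 := by simpa using hμ
  have hb := hasWirt_β hh hU hu j hp
  have hs := (hb.mul hb.conj).sub (((hasWirt_γ hμ hμ1 hh hU hu j hp).mul
    (hasWirt_γ_one_sub hμ hμ1 hh hU hu j hp)).const_mul (μ * conj μ))
  simp only [← ofReal_g] at hs
  -- As `g_j` is real, only its `∂_z` coefficient has to be computed.
  refine (hs.congr_coeff rfl hs.eq_conj).congr_coeff ?_ ?_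
  all_goals
    try refine congrArg conj ?_
    simp only [dzg, map_mul, map_inv₀, map_div₀, conj_expV, conj_sgn]
    have e0 := expV_ne_zero u j p
    field_simp

/-- The derivative `∂_z̄ ∂_z g_j`. -/
noncomputable def laplaceG (l : ℕ) (u : ℕ → ℂ → ℝ) (μ : ℂ) (h : ZMod (2 * l + 2) → ℂ → ℂ)
    (j : ZMod (2 * l + 2)) (p : ℂ) : ℂ :=
  let x := h j p
  let X := h (j + 1) p
  let y := h (2 - j) p
  let Y := h (1 - j) p
  let e := expV l u (j + 1) p
  let f := expV l u j p
  e / f * (sgn j * (Y * X + y * x) * conj (β l h j p)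
      + sgn j * (conj Y * conj X + conj y * conj x) * β l h j p)
    + μ * conj μ * (y * X * conj (y * X))
    + (μ * conj μ)⁻¹ * (e / f) ^ 2 * (Y * x * conj (Y * x))
    - e / f * ((Y * conj Y * e + μ * conj μ * (y * conj y) * f) * γ l u μ h (1 - j) p
      + (x * conj x / f + μ * conj μ * (X * conj X) / e) * γ l u μ h j p)
    - e / f * (y * conj Y * conj X * x + X * conj x * conj y * Y)

/-- Only `∂_z̄` of `∂_z g_j` enters the Laplacian, so the other coefficient stays unspecified. The
derivatives of the exponents cancel here too. -/
theorem hasWirt_dzg (hμ : μ ≠ 0) (hμ1 : ‖μ‖ ≠ 1) (hh : IsLaxSolution l U u μ h) (hU : IsOpen U)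
    (hu : ∀ j, 1 ≤ j → j ≤ l → ContDiffOn ℝ 2 (u j) U) (j : ZMod (2 * l + 2)) {p : ℂ}
    (hp : p ∈ U) :
    ∃ c, HasWirt (dzg l u μ h j) c (laplaceG l u μ h j p) p := by
  have hμc : conj μ ≠ 0 := by simpa using hμ
  have e0 := expV_ne_zero u j p
  have e1 := expV_ne_zero u (j + 1) p
  have hx := hh.hasWirt hU hu j hp
  have hX := hh.hasWirt hU hu (j + 1) hp
  have hy := hh.hasWirt hU hu (2 - j) hp
  have hY := hh.hasWirt hU hu (1 - j) hp
  have he := hasWirt_expV hU hu (j + 1) hp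
  have hf := hasWirt_expV hU hu j hp
  have hW : dzExponent l u (1 - j) p = -dzExponent l u (j + 1) p := by
    have := (hasWirt_exponent hU hu (j + 1) hp).neg
    simp only [← Complex.ofReal_neg, ← exponent_two_sub, show 2 - (j + 1) = 1 - j by ring] at this
    rw [dzExponent, this.dz_eq]
  rw [add_sub_cancel_right] at hX
  rw [show 2 - j - 1 = 1 - j by ring, expV_two_sub, expV_one_sub] at hy
  rw [show 1 - j + 1 = 2 - j by ring, hW] at hY
  have hb := hasWirt_β hh hU hu j hp
  have hγ := hasWirt_γ hμ hμ1 hh hU hu j hp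
  have hγ' := hasWirt_γ_one_sub hμ hμ1 hh hU hu j hp
  have h1 := (((hy.mul hX).const_mul (sgn j)).const_mul μ).mul hb.conj
  have h2 := ((((he.div hf e0).mul (hY.conj.mul hx.conj)).const_mul (sgn j)).const_mul
    (conj μ)⁻¹).mul hb
  have h3 := ((((hy.mul hY.conj).mul he).mul hγ').add
    (((hX.mul hx.conj).div hf e0).mul hγ)).const_mul μ
  refine ⟨_, ((h1.add h2).sub h3).congr_coeff rfl ?_⟩
  simp only [laplaceG, map_mul, map_add, map_neg, conj_sgn]
  have hss := sgn_mul_self j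
  generalize sgn j = s at *
  rcases mul_self_eq_one_iff.1 hss with rfl | rfl
  · field_simp
    ring
  · field_simp
    ring

/-- The bilinear form of the two dimensional Toda equation. -/
theorem g_bilinear (hμ : μ ≠ 0) (hμ1 : ‖μ‖ ≠ 1) {p : ℂ}
    (hc : ∑ c, sgn c * (h (2 - c) p * h c p) = 0) (j : ZMod (2 * l + 2)) :
    (g l u μ h j p : ℂ) * laplaceG l u μ h j p - dzg l u μ h j p * conj (dzg l u μ h j p)
      = expV l u (j + 1) p / expV l u j p
        * ((g l u μ h j p : ℂ) ^ 2 - g l u μ h (j + 1) p * g l u μ h (j - 1) p) := by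
  have hμc : conj μ ≠ 0 := by simpa using hμ
  have e0 := expV_ne_zero u j p
  have e1 := expV_ne_zero u (j + 1) p
  -- The recurrences express all neighbouring `β` and `γ` through `β_j`, `γ_j` and `γ_{1-j}`, which
  -- reduces the claim to a rational identity.
  have b1 := β_sub_one hc j
  have b2 := β_sub_one hc (j + 1)
  have b1' : β l h (j - 1) p = β l h j p - sgn j * (h (2 - j) p * h j p) := by
    linear_combination -b1
  have b2' : β l h (j + 1) p = β l h j p - sgn j * (h (1 - j) p * h (j + 1) p) := by
    rw [add_sub_cancel_right, sgn_add_one, show 2 - (j + 1) = 1 - j by ring] at b2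
    linear_combination b2
  have c1 := γ_sub_one (u := u) (h := h) hμ1 j p
  have c2 := γ_sub_one (u := u) (h := h) hμ1 (j + 1) p
  have c3 := γ_sub_one (u := u) (h := h) hμ1 (1 - j) p
  have c4 := γ_sub_one (u := u) (h := h) hμ1 (2 - j) p
  rw [expV_two_sub] at c1
  rw [add_sub_cancel_right, show 2 - (j + 1) = 1 - j by ring, expV_one_sub] at c2
  rw [show 2 - (1 - j) = j + 1 by ring] at c3
  rw [sub_sub_cancel, show 2 - j - 1 = 1 - j by ring] at c4
  have c1' : (γ l u μ h (j - 1) p : ℂ) = (μ * conj μ)⁻¹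
      * (h (2 - j) p * conj (h (2 - j) p) * expV l u j p - γ l u μ h j p) := by
    field_simp at c1 ⊢
    linear_combination c1
  have c2' : (γ l u μ h (j + 1) p : ℂ) = h (1 - j) p * conj (h (1 - j) p) * expV l u (j + 1) p
      - μ * conj μ * γ l u μ h j p := by
    field_simp at c2 ⊢
    linear_combination c2
  have c3' : (γ l u μ h (1 - j - 1) p : ℂ) = (μ * conj μ)⁻¹
      * (h (j + 1) p * conj (h (j + 1) p) / expV l u (j + 1) p - γ l u μ h (1 - j) p) := by
    field_simp at c3 ⊢
    linear_combination c3
  have c4' : (γ l u μ h (2 - j) p : ℂ) = h j p * conj (h j p) / expV l u j p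
      - μ * conj μ * γ l u μ h (1 - j) p := by
    linear_combination c4
  rw [ofReal_g, ofReal_g, ofReal_g, show 1 - (j + 1) = 1 - j - 1 by ring,
    show 1 - (j - 1) = 2 - j by ring, b1', b2', c1', c2', c3', c4']
  simp only [dzg, laplaceG, map_mul, map_add, map_sub, map_inv₀, map_div₀, conj_expV, conj_sgn,
    Complex.conj_conj, Complex.conj_ofReal]
  have hss := sgn_mul_self j
  generalize sgn j = s at *
  -- With the sign fixed to `1` or `-1`, the identity is purely algebraic.
  rcases mul_self_eq_one_iff.1 hss with rfl | rfl
  · field_simp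
    ring
  · field_simp
    ring

theorem contDiffOn_g (hh : IsLaxSolution l U u μ h) (hU : IsOpen U)
    (hu : ∀ j, 1 ≤ j → j ≤ l → ContDiffOn ℝ 2 (u j) U) (j : ZMod (2 * l + 2)) :
    ContDiffOn ℝ 2 (g l u μ h j) U :=
  ((((contDiffOn_β hh hU hu j).norm_sq ℝ).sub
    ((contDiffOn_const.mul (contDiffOn_γ hh hU hu j)).mul (contDiffOn_γ hh hU hu (1 - j))))).congr
    fun p _ => g_eq j p

/-- `Δ ln g = (g Δ g - |∂_z g|²) / g²`, and the numerator is given by the bilinear identity. -/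
theorem laplacian_log_g (hμ : μ ≠ 0) (hμ1 : ‖μ‖ ≠ 1) (hh : IsLaxSolution l U u μ h)
    (hU : IsOpen U) (hu : ∀ j, 1 ≤ j → j ≤ l → ContDiffOn ℝ 2 (u j) U)
    (hc : ∀ p ∈ U, ∑ c, sgn c * (h (2 - c) p * h c p) = 0) (j : ZMod (2 * l + 2))
    (hg : ∀ p ∈ U, g l u μ h j p ≠ 0) {p : ℂ} (hp : p ∈ U) :
    Laplacian.laplacian (fun q => Real.log (g l u μ h j q)) p
      = Real.exp (exponent l u (j + 1) p - exponent l u j p)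
        * (1 - g l u μ h (j + 1) p * g l u μ h (j - 1) p / g l u μ h j p ^ 2) := by
  have hg0 : (g l u μ h j p : ℂ) ≠ 0 := by exact_mod_cast hg p hp
  obtain ⟨c, hd⟩ := hasWirt_dzg hμ hμ1 hh hU hu j hp
  have h1 := laplacian_eq_of_hasWirt hU hp ((contDiffOn_g hh hU hu j).log hg)
    (A := fun q => dzg l u μ h j q / g l u μ h j q)
    (B := fun q => conj (dzg l u μ h j q) / g l u μ h j q)
    (fun q hq => ((hasWirt_g hμ hμ1 hh hU hu j hq).real_comp
      (Real.hasDerivAt_log (hg q hq))).congr_coeff (by push_cast; ring) (by push_cast; ring))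
    (hd.div (hasWirt_g hμ hμ1 hh hU hu j hp) hg0)
  have h2 := g_bilinear (u := u) hμ hμ1 (hc p hp) j
  have h3 : laplaceG l u μ h j p / (g l u μ h j p : ℂ)
      - dzg l u μ h j p * conj (dzg l u μ h j p) / (g l u μ h j p : ℂ) ^ 2
      = ((g l u μ h j p : ℂ) * laplaceG l u μ h j p
        - dzg l u μ h j p * conj (dzg l u μ h j p)) / (g l u μ h j p : ℂ) ^ 2 := by
    field_simp
  rw [h3, h2] at h1
  rw [← Complex.ofReal_inj, h1, Real.exp_sub]
  simp only [expV]
  push_cast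
  field_simp

/-- `β_j` changes sign while `γ_j` and `γ_{1-j}` trade places. This supplies the boundary conditions
at both ends of the chain. -/
theorem g_one_sub {p : ℂ} (hc : ∑ c, sgn c * (h (2 - c) p * h c p) = 0)
    (j : ZMod (2 * l + 2)) : g l u μ h (1 - j) p = g l u μ h j p := by
  rw [g_eq, g_eq, β_one_sub hc, norm_neg, sub_sub_cancel]
  ring

end Bilinear

/-! ### The Darboux transform -/

section Darboux

variable {l : ℕ} {U : Set ℂ} {u : ℕ → ℂ → ℝ} {μ : ℂ} {h : ZMod (2 * l + 2) → ℂ → ℂ}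

theorem g_ne_zero {p : ℂ} (hpos : ∀ j : ℕ, 1 ≤ j → j ≤ l →
      0 < g l u μ h ((j : ZMod (2 * l + 2)) + 1) p / g l u μ h (j : ZMod (2 * l + 2)) p)
    (hl : 1 ≤ l) {j : ℕ} (h1 : 1 ≤ j) (h2 : j ≤ l + 1) :
    g l u μ h (j : ZMod (2 * l + 2)) p ≠ 0 := by
  intro h0
  -- A quotient with zero numerator or zero denominator is `0`, hence not positive. The index `l +
  -- 1` occurs only as a numerator.
  rcases Nat.lt_or_ge l j with h3 | h3
  · obtain rfl : j = l + 1 := by omega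
    have := hpos l hl le_rfl
    push_cast at h0
    simp [h0] at this
  · have := hpos j h1 h3
    simp [h0] at this

theorem exp_darboux {j : ℕ} {p : ℂ} (hpos :
      0 < g l u μ h ((j : ZMod (2 * l + 2)) + 1) p / g l u μ h (j : ZMod (2 * l + 2)) p) :
    Real.exp (darboux l u μ h j p) = Real.exp (u j p)
      * (g l u μ h ((j : ZMod (2 * l + 2)) + 1) p / g l u μ h (j : ZMod (2 * l + 2)) p) := by
  rw [darboux, Real.exp_add, Real.exp_log hpos]

theorem laplacian_darboux (hμ : μ ≠ 0) (hμ1 : ‖μ‖ ≠ 1) (hh : IsLaxSolution l U u μ h)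
    (hU : IsOpen U) (hu : ∀ j, 1 ≤ j → j ≤ l → ContDiffOn ℝ 2 (u j) U)
    (hc : ∀ p ∈ U, ∑ c, sgn c * (h (2 - c) p * h c p) = 0) {j : ℕ} (hj : 1 ≤ j) (hjl : j ≤ l)
    (hg : ∀ p ∈ U, g l u μ h j p ≠ 0) (hg' : ∀ p ∈ U, g l u μ h (j + 1) p ≠ 0) {p : ℂ}
    (hp : p ∈ U) :
    Laplacian.laplacian (darboux l u μ h j) p = Laplacian.laplacian (u j) p
      + Real.exp (exponent l u (j + 2) p - u j p)
        * (1 - g l u μ h (j + 2) p * g l u μ h j p / g l u μ h (j + 1) p ^ 2)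
      - Real.exp (u j p - exponent l u j p)
        * (1 - g l u μ h (j + 1) p * g l u μ h (j - 1) p / g l u μ h j p ^ 2) := by
  have hn := hU.mem_nhds hp
  have hC0 := (hu j hj hjl).contDiffAt hn
  have hC1 := ((contDiffOn_g (μ := μ) hh hU hu ((j : ZMod (2 * l + 2)) + 1)).log hg').contDiffAt hn
  have hC2 := ((contDiffOn_g (μ := μ) hh hU hu (j : ZMod (2 * l + 2))).log hg).contDiffAt hn
  have hC12 : ContDiffAt ℝ 2 ((fun q => Real.log (g l u μ h ((j : ZMod (2 * l + 2)) + 1) q))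
      - fun q => Real.log (g l u μ h (j : ZMod (2 * l + 2)) q)) p := hC1.sub hC2
  have he : darboux l u μ h j =ᶠ[nhds p]
      u j + ((fun q => Real.log (g l u μ h ((j : ZMod (2 * l + 2)) + 1) q))
        - fun q => Real.log (g l u μ h (j : ZMod (2 * l + 2)) q)) := by
    filter_upwards [hn] with q hq
    simp only [darboux, Pi.add_apply, Pi.sub_apply]
    -- The `g_j` may be negative; `Real.log` is the logarithm of the absolute value, so nonvanishing
    -- suffices.
    rw [Real.log_div (hg' q hq) (hg q hq)]
  rw [(InnerProductSpace.laplacian_congr_nhds he).eq_of_nhds, hC0.laplacian_add hC12,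
    hC1.laplacian_sub hC2, laplacian_log_g hμ hμ1 hh hU hu hc _ hg' hp,
    laplacian_log_g hμ hμ1 hh hU hu hc _ hg hp, add_sub_cancel_right,
    show (j : ZMod (2 * l + 2)) + 1 + 1 = j + 2 by ring, add_comm (j : ZMod (2 * l + 2)) 1,
    exponent_one_add u hj hjl]
  ring

theorem contDiffOn_darboux (hh : IsLaxSolution l U u μ h)
    (hU : IsOpen U) (hu : ∀ j, 1 ≤ j → j ≤ l → ContDiffOn ℝ 2 (u j) U)
    {j : ℕ} (hj : 1 ≤ j) (hjl : j ≤ l)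
    (hg : ∀ p ∈ U, g l u μ h j p ≠ 0) (hg' : ∀ p ∈ U, g l u μ h (j + 1) p ≠ 0) :
    ContDiffOn ℝ 2 (darboux l u μ h j) U :=
  (hu j hj hjl).add (((contDiffOn_g hh hU hu _).div (contDiffOn_g hh hU hu _) hg).log
    fun p hp => div_ne_zero (hg' p hp) (hg p hp))

theorem exponent_natCast {j : ℕ} (h1 : 2 ≤ j) (h2 : j ≤ l + 1) (p : ℂ) :
    exponent l u (j : ZMod (2 * l + 2)) p = u (j - 1) p := by
  rw [← exponent_one_add (l := l) u (by omega : 1 ≤ j - 1) (by omega), Nat.cast_sub (by omega)]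
  simp

end Darboux

end D2Toda

theorem mainTheorem7 (l : ℕ) (hl : 2 ≤ l) (U : Set ℂ) (hU : IsOpen U)
    (u : ℕ → ℂ → ℝ) (hu : D2Toda.IsTodaSolution l U u)
    (μ : ℂ) (hμ : μ ≠ 0) (hμ1 : ‖μ‖ ≠ 1)
    (h : ZMod (2 * l + 2) → ℂ → ℂ) (hh : D2Toda.IsLaxSolution l U u μ h)
    (hconstr : ∀ p ∈ U,
      h 1 p ^ 2 + (-1 : ℂ) ^ (l + 1) * h ((l : ZMod (2 * l + 2)) + 2) p ^ 2
        + 2 * ∑ c ∈ Finset.Icc 2 (l + 1),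
            (-1 : ℂ) ^ (c - 1) * h (c : ZMod (2 * l + 2)) p
              * h (2 - (c : ZMod (2 * l + 2))) p = 0)
    (hpos : ∀ p ∈ U, ∀ j : ℕ, 1 ≤ j → j ≤ l →
      0 < D2Toda.g l u μ h ((j : ZMod (2 * l + 2)) + 1) p
        / D2Toda.g l u μ h (j : ZMod (2 * l + 2)) p) :
    D2Toda.IsTodaSolution l U (D2Toda.darboux l u μ h) := by
  have hc : ∀ p ∈ U, ∑ c, D2Toda.sgn c * (h (2 - c) p * h c p) = 0 := fun p hp =>
    D2Toda.sum_sgn_of_constraint (hconstr p hp)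
  have hg : ∀ j : ℕ, 1 ≤ j → j ≤ l → ∀ p ∈ U, D2Toda.g l u μ h j p ≠ 0 := fun j h1 h2 p hp =>
    D2Toda.g_ne_zero (hpos p hp) (by omega) h1 (by omega)
  have hg' : ∀ j : ℕ, 1 ≤ j → j ≤ l → ∀ p ∈ U, D2Toda.g l u μ h (j + 1) p ≠ 0 := by
    intro j h1 h2 p hp
    have := D2Toda.g_ne_zero (hpos p hp) (by omega) (by omega : 1 ≤ j + 1) (by omega)
    push_cast at this
    exact this
  have hΔ : ∀ j : ℕ, 1 ≤ j → j ≤ l → ∀ p ∈ U, _ := fun j h1 h2 p hp =>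
    D2Toda.laplacian_darboux hμ hμ1 hh hU hu.contDiffOn hc h1 h2 (hg j h1 h2) (hg' j h1 h2) hp
  refine ⟨fun j h1 h2 => D2Toda.contDiffOn_darboux hh hU hu.contDiffOn h1 h2 (hg j h1 h2)
    (hg' j h1 h2), fun p hp => ?_, fun j h1 h2 p hp => ?_, fun p hp => ?_⟩
  · have a1 := hg 1 le_rfl (by omega) p hp
    have a2 := hg' 1 le_rfl (by omega) p hp
    -- This is `g_0 = g_1`, which turns `g_2 g_0 / g_1²` into the ratio `g_2 / g_1` in `e^{ũ_1}`.
    have a0 := D2Toda.g_one_sub (u := u) (μ := μ) (hc p hp) 1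
    have e3 := D2Toda.exponent_natCast (u := u) (by omega : 2 ≤ 3) (by omega : 3 ≤ l + 1) p
    rw [hΔ 1 le_rfl (by omega) p hp, hu.eq_first p hp, Real.exp_sub (D2Toda.darboux l u μ h 2 p),
      D2Toda.exp_darboux (hpos p hp 1 le_rfl (by omega)),
      D2Toda.exp_darboux (hpos p hp 2 (by omega) hl)]
    push_cast at a1 a2 e3 ⊢
    rw [show (1 : ZMod (2 * l + 2)) + 2 = 3 by norm_num, e3, D2Toda.exponent_one, a0]
    rw [show (1 : ZMod (2 * l + 2)) + 1 = 2 by norm_num] at a2 ⊢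
    rw [show (2 : ZMod (2 * l + 2)) + 1 = 3 by norm_num, sub_zero]
    simp only [Real.exp_sub]
    field_simp
    ring
  · have a0 := hg (j - 1) (by omega) (by omega) p hp
    have a1 := hg j (by omega) (by omega) p hp
    have a2 := hg' j (by omega) (by omega) p hp
    have e0 := D2Toda.exponent_natCast (u := u) h1 (by omega : j ≤ l + 1) p
    have e2 := D2Toda.exponent_natCast (u := u) (by omega : 2 ≤ j + 2) (by omega : j + 2 ≤ l + 1) p
    have p0 := hpos p hp (j - 1) (by omega) (by omega)
    have p2 := hpos p hp (j + 1) (by omega) (by omega)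
    rw [hΔ j (by omega) (by omega) p hp, hu.eq_middle j h1 h2 p hp,
      Real.exp_sub (D2Toda.darboux l u μ h j p),
      Real.exp_sub (D2Toda.darboux l u μ h (j + 1) p), D2Toda.exp_darboux p0,
      D2Toda.exp_darboux (hpos p hp j (by omega) (by omega)), D2Toda.exp_darboux p2]
    push_cast [Nat.cast_sub (by omega : 1 ≤ j)] at a0 a1 a2 e0 e2 ⊢
    rw [e0, e2, sub_add_cancel, show (j : ZMod (2 * l + 2)) + 1 + 1 = j + 2 by ring]
    simp only [Real.exp_sub]
    field_simp
    ring
  · have a0 := hg (l - 1) (by omega) (by omega) p hp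
    have a1 := hg l (by omega) le_rfl p hp
    have a2 := hg' l (by omega) le_rfl p hp
    -- With `hN` this is `g_{l+1} = g_{l+2}`, which turns `g_{l+2} g_l / g_{l+1}²` into the ratio
    -- `g_l / g_{l+1}` in `e^{-ũ_l}`.
    have a3 := D2Toda.g_one_sub (u := u) (μ := μ) (hc p hp) ((l : ZMod (2 * l + 2)) + 2)
    have e0 := D2Toda.exponent_natCast (u := u) hl (by omega : l ≤ l + 1) p
    have hN : (1 : ZMod (2 * l + 2)) - (l + 2) = l + 1 := by
      have := ZMod.natCast_self (2 * l + 2)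
      push_cast at this
      linear_combination -this
    rw [hN] at a3
    rw [hΔ l (by omega) le_rfl p hp, hu.eq_last p hp,
      Real.exp_sub (D2Toda.darboux l u μ h l p), Real.exp_neg (D2Toda.darboux l u μ h l p),
      D2Toda.exp_darboux (hpos p hp (l - 1) (by omega) (by omega)),
      D2Toda.exp_darboux (hpos p hp l (by omega) le_rfl), ← a3, D2Toda.exponent_natCast_add_two]
    push_cast [Nat.cast_sub (by omega : 1 ≤ l)] at a0 e0 ⊢
    rw [e0, sub_add_cancel, zero_sub]
    simp only [Real.exp_sub, Real.exp_neg]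
    field_simp
    ring
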